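/- Let $\Delta\subset\mathbb C$ be the unit disk with the Poincaré metric $|dz|^2/(1-|z|^2)^2$, whose norm is $\|v\|_P=|v|/(1-|z|^2)$ for $v\in T_z\Delta$ and whose distance is $\ell_P(z,w)=\frac12\log\frac{1+m}{1-m}$ with $m=\left|\frac{z-w}{1-\bar w z}\right|$; put $\ell_P(z)=\ell_P(0,z)$. For a connected (finite-dimensional, Hausdorff, second countable) complex manifold $M$ let $\mathrm{Hol}(M,\Delta)$ be the set of holomorphic maps $M\to\Delta$, and put $$E_M(x,v)=\sup\{\|df_x(v)\|_P : f\in \mathrm{Hol}(M,\Delta),\ f(x)=0\},\qquad d_{C,M}(p,q)=\sup\{\ell_P(f(p),f(q)) : f\in\mathrm{Hol}(M,\Delta)\}.$$ Call $M$ strongly Carathéodory hyperbolic if $E_M(x,v)>0$ for all $x\in M$ and $0\ne v\in T_xM$, $d_{C,M}(p,q)>0$ for all $p\neq q$, and $d_{C,M}$ is complete, in the sense that the closed balls $\{q : d_{C,M}(p,q)\le r\}$, $p\in M$, $0\le r<\infty$, are compact subsets of $M$. Let $M$ be a strongly Carathéodory hyperbolic complex manifold. Then $M$ is hyperconvex: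 there are a constant $C\in\mathbb R$ and a plurisubharmonic function $\varphi$ on $M$ with $\varphi<C$ such that $\{\varphi<c\}$ is relatively compact in $M$ for every $c<C$. Moreover, for every $p\in M$ such a function can be obtained as follows. There are $a\in(0,\tfrac12)$, a smooth function $\rho:\mathbb C\to[0,1]$ with $\rho(z)=0$ for $|z|<a$ and $\rho(z)=1$ for $|z|\ge 2a$, and constants $\lambda,\varepsilon_0>0$ such that for every $h\in\mathrm{Hol}(M,\Delta)$ with $h(p)=0$ the function $$l_{h,p}=\lambda|h|^2+\rho(h)\,\ell_P(h)$$ is plurisubharmonic on $M$, and such that for every $0<\varepsilon\le\varepsilon_0$ the function $$\varphi_p=\sup\{\tanh(\varepsilon\, l_{h,p}) : h\in\mathrm{Hol}(M,\Delta),\ h(p)=0\}$$ is plurisubharmonic on $M$, takes values in $[0,1)$, and $\{\varphi_p<c\}$ is relatively compact in $M$ for every $c<1$. -/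

import Mathlib

open scoped Manifold ContDiff ENNReal NNReal Topology

noncomputable section

/-! A complex manifold is a manifold `M` modelled on a finite-dimensional complex normed space `E`,
with `IsManifold 𝓘(ℂ, E) ω M`. The unit disk `Δ` is `{z : ℂ | ‖z‖ < 1}`. -/

/-- The Poincaré norm `|v| / (1 - |z|²)` of a tangent vector `v` to the unit disk at `z`. -/
def poincareNorm (z v : ℂ) : ℝ := ‖v‖ / (1 - ‖z‖ ^ 2)

/-- The Poincaré distance on the unit disk, for the metric `|dz|² / (1 - |z|²)²`: it is
`(1/2) log ((1 + m) / (1 - m))` with `m = |z - w| / |1 - conj w * z|`. -/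
def poincareDist (z w : ℂ) : ℝ :=
  1 / 2 * Real.log
    ((1 + ‖(z - w) / (1 - starRingEnd ℂ w * z)‖) / (1 - ‖(z - w) / (1 - starRingEnd ℂ w * z)‖))

section Manifold

variable (E : Type*) [NormedAddCommGroup E] [NormedSpace ℂ E]

/-- `Hol(M, Δ)`: the holomorphic maps from `M` to the unit disk. -/
def HolDisk (M : Type*) [TopologicalSpace M] [ChartedSpace E M] : Set (M → ℂ) :=
  {f | MDifferentiable 𝓘(ℂ, E) 𝓘(ℂ, ℂ) f ∧ ∀ x, ‖f x‖ < 1}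

variable {M : Type*} [TopologicalSpace M] [ChartedSpace E M]

/-- The infinitesimal Carathéodory pseudo-metric: the supremum of the Poincaré norms of `df_x(v)`
over the holomorphic maps `f : M → Δ` with `f x = 0`. -/
def caratheodoryMetric (x : M) (v : TangentSpace 𝓘(ℂ, E) x) : ℝ≥0∞ :=
  ⨆ f ∈ {f ∈ HolDisk E M | f x = 0},
    ENNReal.ofReal (poincareNorm (f x) (mfderiv 𝓘(ℂ, E) 𝓘(ℂ, ℂ) f x v : ℂ))

/-- The Carathéodory pseudo-distance: the supremum of the Poincaré distances of `f p` and `f q`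
over the holomorphic maps `f : M → Δ`. -/
def caratheodoryDist (p q : M) : ℝ≥0∞ :=
  ⨆ f ∈ HolDisk E M, ENNReal.ofReal (poincareDist (f p) (f q))

variable (M)

/-- `M` is Carathéodory hyperbolic: the infinitesimal Carathéodory pseudo-metric is nondegenerate
at every point. -/
def CaratheodoryHyperbolic : Prop :=
  ∀ (x : M) (v : TangentSpace 𝓘(ℂ, E) x), v ≠ 0 → 0 < caratheodoryMetric E x v

/-- `M` is strongly Carathéodory hyperbolic: it is Carathéodory hyperbolic and the Carathéodory
pseudo-distance is nondegenerate and complete, in the sense that its closed balls of finite radius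
are compact subsets of `M`. -/
structure StronglyCaratheodoryHyperbolic : Prop where
  hyperbolic : CaratheodoryHyperbolic E M
  nondegenerate : ∀ p q : M, p ≠ q → 0 < caratheodoryDist E p q
  complete : ∀ (p : M) (r : ℝ≥0), IsCompact {q : M | caratheodoryDist E p q ≤ r}

end Manifold

section Plurisubharmonic

variable {E : Type*} [NormedAddCommGroup E] [NormedSpace ℂ E]

/-- A finite-valued function `u` is plurisubharmonic on the open set `U`: it is upper semicontinuous
and satisfies the sub-mean value inequality on all closed disks in complex lines that lie in `U`.
(For such a `u` the mean is never `-∞`, as `u z` is finite; hence the integrability clause.) -/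
def PlurisubharmonicOn (u : E → ℝ) (U : Set E) : Prop :=
  UpperSemicontinuousOn u U ∧
    ∀ z w : E, (∀ ζ : ℂ, ‖ζ‖ ≤ 1 → z + ζ • w ∈ U) →
      CircleIntegrable (fun ζ : ℂ => u (z + ζ • w)) 0 1 ∧
        u z ≤ Real.circleAverage (fun ζ : ℂ => u (z + ζ • w)) 0 1

variable (E) {M : Type*} [TopologicalSpace M] [ChartedSpace E M]

/-- A finite-valued function on a complex manifold is plurisubharmonic if it is so in every
holomorphic chart. -/
def Plurisubharmonic (φ : M → ℝ) : Prop :=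
  ∀ e ∈ IsManifold.maximalAtlas 𝓘(ℂ, E) ω M, PlurisubharmonicOn (φ ∘ e.symm) e.target

/-- `φ` is an exhaustion function of `M` bounded from above by `C`: it takes values below `C`, and
`{φ < c}` is relatively compact for every `c < C`. -/
def IsExhaustionBoundedBy (φ : M → ℝ) (C : ℝ) : Prop :=
  (∀ x, φ x < C) ∧ ∀ c < C, IsCompact (closure {x | φ x < c})

variable (M)

/-- `M` is hyperconvex: it has a plurisubharmonic exhaustion function bounded from above. Allowing
the value `-∞` gives the same notion, as one may replace `φ` by `max φ (C - 1)`. -/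
def Hyperconvex : Prop :=
  ∃ (φ : M → ℝ) (C : ℝ), Plurisubharmonic E φ ∧ IsExhaustionBoundedBy φ C

end Plurisubharmonic

/-- `ρ` is a smooth cutoff function with values in `[0, 1]` that vanishes on the disk `Δ(0, a)` and
equals `1` off the disk `Δ(0, 2a)`. -/
structure IsCutoff (a : ℝ) (ρ : ℂ → ℝ) : Prop where
  smooth : ContDiff ℝ ∞ ρ
  mem_Icc : ∀ z, ρ z ∈ Set.Icc (0 : ℝ) 1
  eq_zero : ∀ z, ‖z‖ < a → ρ z = 0
  eq_one : ∀ z, 2 * a ≤ ‖z‖ → ρ z = 1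

/-- The function `l_h = c |h|² + ρ(h) ℓ_P(h)`, where `ℓ_P(z)` is the Poincaré distance from `0`
to `z`. -/
def ellFun {M : Type*} (c : ℝ) (ρ : ℂ → ℝ) (h : M → ℂ) (x : M) : ℝ :=
  c * ‖h x‖ ^ 2 + ρ (h x) * poincareDist 0 (h x)

/-- The function `φ_p = sup_h tanh (ε l_h)`, the supremum being over the holomorphic maps
`h : M → Δ` with `h p = 0`. -/
def supTanh (E : Type*) [NormedAddCommGroup E] [NormedSpace ℂ E] {M : Type*} [TopologicalSpace M]
    [ChartedSpace E M] (c : ℝ) (ρ : ℂ → ℝ) (ε : ℝ) (p x : M) : ℝ :=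
  ⨆ h : {h ∈ HolDisk E M | h p = 0}, Real.tanh (ε * ellFun c ρ h.1 x)

end

noncomputable section

open Metric Set Filter

/-! On the disk, `l = c|z|² + ρ ℓ_P` is a function `ψ` of `t = log |z|`. If `ψ' ≥ 0` and `2ε ψ'² ≤
ψ''`, then both `ψ` and `tanh (ε ψ)` are nondecreasing and convex in `t`, so composing either with a
holomorphic map to the disk gives a plurisubharmonic function. The term `c|z|²` pays for the cutoff
where `ρ` varies. Near the circle `ℓ_P` itself satisfies `(ℓ_P')² ≤ ℓ_P''`
(`exists_truncProfile_estimate`, `exists_isLogConvexRadial`).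

The supremum over `h` needs no upper regularization, because it is already continuous. By a Harnack
inequality and connectedness, the values `h x` of maps with `h p = 0` stay in a compact subdisk
(`HolDisk.exists_norm_le`), and the Schwarz lemma makes these maps equicontinuous. The same
compactness gives `φ_p < 1`.

Since `ℓ_P ≤ l + const`, a sublevel set of `φ_p` lies in a Carathéodory ball around `p`, which is
compact by completeness. -/

/-! ### Subharmonicity of radial functions convex in `log ‖z‖`. -/

/-- Sub-mean value inequality for `log ‖g‖`. -/
theorem log_norm_le_circleAverage {g : ℂ → ℂ} (hg : AnalyticOnNhd ℂ g (closedBall 0 1))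
    (h0 : g 0 ≠ 0) : Real.log ‖g 0‖ ≤ Real.circleAverage (fun ζ => Real.log ‖g ζ‖) 0 1 := by
  have hg' : AnalyticOnNhd ℂ g (closedBall 0 |(1 : ℝ)|) := by rwa [abs_one]
  -- Jensen's formula: the excess of the average over `log ‖g 0‖` is the sum of `log (1 / ‖u‖)` over
  -- the zeros `u`, with multiplicity.
  rw [AnalyticOnNhd.circleAverage_log_norm one_ne_zero hg' h0]
  refine le_add_of_nonneg_left (finsum_nonneg fun u => ?_)
  have hD : (0 : ℤ) ≤ MeromorphicOn.divisor g (closedBall 0 |(1 : ℝ)|) u :=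
    MeromorphicOn.AnalyticOnNhd.divisor_nonneg hg' u
  by_cases hu : u ∈ closedBall (0 : ℂ) |(1 : ℝ)|
  · refine mul_nonneg (by exact_mod_cast hD) ?_
    rw [one_mul, zero_sub, norm_neg]
    rcases eq_or_ne u 0 with rfl | hu0
    · simp
    · exact Real.log_nonneg ((one_le_inv₀ (norm_pos_iff.2 hu0)).2 (by simpa using hu))
  · rw [Function.locallyFinsuppWithin.apply_eq_zero_of_notMem _ hu]
    simp

/-- A convex function lies above its tangent lines. -/
theorem ConvexOn.add_mul_sub_le_of_hasDerivAt {S : Set ℝ} {f : ℝ → ℝ} {f' s t : ℝ}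
    (hf : ConvexOn ℝ S f) (hs : s ∈ S) (ht : t ∈ S) (hd : HasDerivAt f f' s) :
    f s + f' * (t - s) ≤ f t := by
  rcases lt_trichotomy s t with h | rfl | h
  · have := hf.le_slope_of_hasDerivAt hs ht h hd
    rw [slope_def_field, le_div_iff₀ (sub_pos.2 h)] at this
    linarith
  · simp
  · have := hf.slope_le_of_hasDerivAt ht hs h hd
    rw [slope_def_field, div_le_iff₀ (sub_pos.2 h)] at this
    linarith

/-- A continuous nonnegative function on the unit disk that vanishes at `0` and is, off `0`, a
nondecreasing convex function of `log ‖z‖`. -/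
structure IsLogConvexRadial (G : ℂ → ℝ) : Prop where
  continuousOn : ContinuousOn G (ball 0 1)
  nonneg : ∀ z, ‖z‖ < 1 → 0 ≤ G z
  map_zero : G 0 = 0
  exists_tangent : ∀ z, z ≠ 0 → ‖z‖ < 1 → ∃ k : ℝ, 0 ≤ k ∧ ∀ w, w ≠ 0 → ‖w‖ < 1 →
    G z + k * (Real.log ‖w‖ - Real.log ‖z‖) ≤ G w

namespace IsLogConvexRadial

variable {G : ℂ → ℝ} (hG : IsLogConvexRadial G) {g : ℂ → ℂ}
  (hg : AnalyticOnNhd ℂ g (closedBall 0 1)) (hg1 : ∀ ζ ∈ closedBall (0 : ℂ) 1, ‖g ζ‖ < 1)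

theorem continuousOn_comp {X : Type*} [TopologicalSpace X] {f : X → ℂ} {S : Set X}
    (hG : IsLogConvexRadial G) (hf : ContinuousOn f S) (hf1 : ∀ x ∈ S, ‖f x‖ < 1) :
    ContinuousOn (fun x => G (f x)) S :=
  hG.continuousOn.comp hf fun x hx => by simpa using hf1 x hx

include hG hg hg1 in
theorem circleIntegrable_comp : CircleIntegrable (fun ζ => G (g ζ)) 0 1 := by
  apply ContinuousOn.circleIntegrable zero_le_one
  exact hG.continuousOn_comp (hg.continuousOn.mono sphere_subset_closedBall)
    fun ζ hζ => hg1 ζ (sphere_subset_closedBall hζ)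

-- The tangent line at `log ‖g 0‖` gives a minorant `const + k log ‖g‖` of `G ∘ g`, with equality at
-- `0`. As `k ≥ 0`, the inequality for `log ‖g‖` suffices. If `g 0 = 0`, then `G ≥ 0 = G 0` does.
include hG hg hg1 in
theorem le_circleAverage_comp : G (g 0) ≤ Real.circleAverage (fun ζ => G (g ζ)) 0 1 := by
  by_cases h0 : g 0 = 0
  · rw [h0, hG.map_zero]
    refine Real.circleAverage_nonneg_of_nonneg fun ζ hζ => hG.nonneg _ (hg1 ζ ?_)
    rw [abs_one] at hζ
    exact sphere_subset_closedBall hζ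
  obtain ⟨k, hk, hkG⟩ := hG.exists_tangent (g 0) h0 (hg1 0 (by simp))
  have hint : CircleIntegrable (fun ζ => Real.log ‖g ζ‖) 0 1 := by
    apply MeromorphicOn.circleIntegrable_log_norm
    intro z hz
    rw [abs_one] at hz
    exact (hg z (sphere_subset_closedBall hz)).meromorphicAt
  set v : ℂ → ℝ := fun ζ => (G (g 0) - k * Real.log ‖g 0‖) + k * Real.log ‖g ζ‖ with hv
  have hc : CircleIntegrable (fun _ : ℂ => G (g 0) - k * Real.log ‖g 0‖) 0 1 :=
    circleIntegrable_const _ _ _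
  have hvint : CircleIntegrable v 0 1 := hc.add (hint.const_fun_smul (a := k))
  have hvavg : Real.circleAverage v 0 1 = (G (g 0) - k * Real.log ‖g 0‖) +
      k * Real.circleAverage (fun ζ => Real.log ‖g ζ‖) 0 1 := by
    have hadd := Real.circleAverage_fun_add hc (hint.const_fun_smul (a := k))
    rwa [Real.circleAverage_const, Real.circleAverage_fun_smul] at hadd
  have hle := mul_le_mul_of_nonneg_left (log_norm_le_circleAverage hg h0) hk
  classical
  -- Since `Real.log 0 = 0`, `v` need not lie below `G ∘ g` at zeros of `g`. Resetting it to `0`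
  -- there restores the bound, and the average is unchanged because the zeros are discrete.
  set v' : ℂ → ℝ := fun ζ => if g ζ = 0 then 0 else v ζ with hv'
  have hvv' : v =ᶠ[codiscreteWithin (sphere (0 : ℂ) |(1 : ℝ)|)] v' := by
    have h := AnalyticOnNhd.preimage_zero_mem_codiscreteWithin hg h0 (by simp)
      ((convex_closedBall (0 : ℂ) 1).isConnected ⟨0, by simp⟩)
    have := Filter.codiscreteWithin_mono (sphere_subset_closedBall (x := (0 : ℂ)) (ε := 1)) h
    rw [abs_one]
    filter_upwards [this] with ζ hζ
    have : g ζ ≠ 0 := hζ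
    simp [hv', this]
  have hv'int : CircleIntegrable v' 0 1 := hvint.congr_codiscreteWithin hvv'
  have hmono : Real.circleAverage v' 0 1 ≤ Real.circleAverage (fun ζ => G (g ζ)) 0 1 := by
    refine Real.circleAverage_mono hv'int (hG.circleIntegrable_comp hg hg1) fun ζ hζ => ?_
    rw [abs_one] at hζ
    have h1 := hg1 ζ (sphere_subset_closedBall hζ)
    by_cases hz : g ζ = 0
    · simpa [hv', hz] using hG.nonneg _ (by simp)
    · have := hkG _ hz h1
      simp only [hv', hz, if_false, hv]
      linarith
  rw [← Real.circleAverage_congr_codiscreteWithin hvv' one_ne_zero, hvavg] at hmono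
  linarith

end IsLogConvexRadial

/-! ### Convexity of `tanh (ε ψ)`. -/

theorem Real.hasDerivAt_tanh (x : ℝ) : HasDerivAt Real.tanh (1 - Real.tanh x ^ 2) x := by
  have h := (Real.hasDerivAt_sinh x).div (Real.hasDerivAt_cosh x) (Real.cosh_pos x).ne'
  refine (h.congr_deriv ?_).congr_of_eventuallyEq (.of_forall Real.tanh_eq_sinh_div_cosh)
  have := (Real.cosh_pos x).ne'
  rw [Real.tanh_eq_sinh_div_cosh]
  field_simp

/-- If `ψ'' ≥ 2 ε (ψ')²`, then `tanh (ε ψ)` is convex. -/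
theorem convexOn_tanh_comp {D : Set ℝ} (hD : Convex ℝ D) {ψ ψ' ψ'' : ℝ → ℝ}
    {ε : ℝ} (hε : 0 ≤ ε) (h1 : ∀ t ∈ D, HasDerivAt ψ (ψ' t) t)
    (h2 : ∀ t ∈ D, HasDerivAt ψ' (ψ'' t) t) (h : ∀ t ∈ D, 2 * ε * ψ' t ^ 2 ≤ ψ'' t) :
    ConvexOn ℝ D fun t => Real.tanh (ε * ψ t) := by
  have d1 : ∀ t ∈ D, HasDerivAt (fun t => Real.tanh (ε * ψ t))
      ((1 - Real.tanh (ε * ψ t) ^ 2) * (ε * ψ' t)) t := fun t ht =>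
    (Real.hasDerivAt_tanh _).comp t ((h1 t ht).const_mul ε)
  have d2 : ∀ t ∈ D, HasDerivAt (fun t => (1 - Real.tanh (ε * ψ t) ^ 2) * (ε * ψ' t))
      ((1 - Real.tanh (ε * ψ t) ^ 2) * (ε * (ψ'' t - 2 * ε * Real.tanh (ε * ψ t) * ψ' t ^ 2)))
      t := fun t ht => by
    refine ((((d1 t ht).pow 2).const_sub 1).mul ((h2 t ht).const_mul ε)).congr_deriv ?_
    simp only [Pi.pow_apply]
    push_cast
    ring
  refine convexOn_of_hasDerivWithinAt2_nonneg hD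
    (fun t ht => (d1 t ht).continuousAt.continuousWithinAt)
    (fun t ht => (d1 t (interior_subset ht)).hasDerivWithinAt)
    (fun t ht => (d2 t (interior_subset ht)).hasDerivWithinAt) fun t ht => ?_
  have ht' := interior_subset ht
  have hlt := Real.abs_tanh_lt_one (ε * ψ t)
  have hsq : Real.tanh (ε * ψ t) ^ 2 < 1 := by rwa [sq_lt_one_iff_abs_lt_one]
  have := h t ht'
  refine mul_nonneg (by linarith) (mul_nonneg hε ?_)
  have : 2 * ε * ψ' t ^ 2 * Real.tanh (ε * ψ t) ≤ 2 * ε * ψ' t ^ 2 * 1 :=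
    mul_le_mul_of_nonneg_left (abs_lt.1 hlt).2.le (by positivity)
  linarith

/-! ### The profile of `l` in the variable `t = log ‖z‖`. -/

/-- The function `log ‖z‖ ↦ poincareDist 0 z`. -/
def logProfile (t : ℝ) : ℝ := 1 / 2 * Real.log ((1 + Real.exp t) / (1 - Real.exp t))

/-- The function `log ‖z‖ ↦ ρ z` for the cutoff function `cutoff`. -/
def cutoffProfile (t : ℝ) : ℝ := Real.smoothTransition ((16 * Real.exp t ^ 2 - 1) / 3)

/-- A radial cutoff function that vanishes on `Δ(0, 1/4)` and equals `1` off `Δ(0, 1/2)`. -/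
def cutoff (z : ℂ) : ℝ := Real.smoothTransition ((16 * ‖z‖ ^ 2 - 1) / 3)

theorem isCutoff_cutoff : IsCutoff (1 / 4) cutoff where
  smooth := by
    -- The square of the norm is smooth at the origin; the affine map sends `1/16` to `0` and `1/4`
    -- to `1`.
    refine Real.smoothTransition.contDiff.comp ?_
    exact ((contDiff_const.mul (contDiff_norm_sq ℝ)).sub contDiff_const).div_const _
  mem_Icc z := ⟨Real.smoothTransition.nonneg _, Real.smoothTransition.le_one _⟩
  eq_zero z hz := Real.smoothTransition.zero_of_nonpos (by nlinarith [norm_nonneg z])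
  eq_one z hz := Real.smoothTransition.one_of_one_le (by nlinarith [norm_nonneg z])

theorem cutoff_eq {z : ℂ} (hz : z ≠ 0) : cutoff z = cutoffProfile (Real.log ‖z‖) := by
  rw [cutoff, cutoffProfile, Real.exp_log (norm_pos_iff.2 hz)]

theorem poincareDist_zero_left (z : ℂ) :
    poincareDist 0 z = 1 / 2 * Real.log ((1 + ‖z‖) / (1 - ‖z‖)) := by
  simp [poincareDist]

theorem poincareDist_zero_eq {z : ℂ} (hz : z ≠ 0) :
    poincareDist 0 z = logProfile (Real.log ‖z‖) := by
  rw [poincareDist_zero_left, logProfile, Real.exp_log (norm_pos_iff.2 hz)]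

theorem one_sub_exp_pos {t : ℝ} (ht : t < 0) : 0 < 1 - Real.exp t := by
  have : Real.exp t < 1 := by simpa using ht
  linarith

theorem hasDerivAt_logProfile {t : ℝ} (ht : t < 0) :
    HasDerivAt logProfile (Real.exp t / (1 - Real.exp t ^ 2)) t := by
  have h1 := one_sub_exp_pos ht
  have h2 : 0 < 1 + Real.exp t := by positivity
  have h3 : 1 - Real.exp t ^ 2 ≠ 0 := by
    have : 0 < (1 - Real.exp t) * (1 + Real.exp t) := mul_pos h1 h2
    nlinarith
  refine (((((Real.hasDerivAt_exp t).const_add 1).div ((Real.hasDerivAt_exp t).const_sub 1)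
    h1.ne').log (div_pos h2 h1).ne').const_mul (1 / 2)).congr_deriv ?_
  have := h1.ne'
  have := h2.ne'
  simp only [Pi.div_apply]
  field_simp
  ring

theorem hasDerivAt_deriv_logProfile {t : ℝ} (ht : t < 0) :
    HasDerivAt (fun t => Real.exp t / (1 - Real.exp t ^ 2))
      (Real.exp t * (1 + Real.exp t ^ 2) / (1 - Real.exp t ^ 2) ^ 2) t := by
  have h3 : 1 - Real.exp t ^ 2 ≠ 0 := by
    have h1 := one_sub_exp_pos ht
    have : 0 < (1 - Real.exp t) * (1 + Real.exp t) := mul_pos h1 (by positivity)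
    nlinarith
  refine ((Real.hasDerivAt_exp t).div (((Real.hasDerivAt_exp t).pow 2).const_sub 1)
    h3).congr_deriv ?_
  simp only [Pi.pow_apply]
  field_simp
  ring

/-- The product of the profiles, of which `ρ(h) ℓ_P(h)` is a composition with `log ‖h‖`. -/
def truncProfile (t : ℝ) : ℝ := cutoffProfile t * logProfile t

theorem contDiffOn_truncProfile : ContDiffOn ℝ 2 truncProfile (Iio 0) := by
  refine ContDiffOn.mul ?_ ?_
  · refine ContDiff.contDiffOn (Real.smoothTransition.contDiff (n := 2) |>.comp ?_)
    exact ((contDiff_const.mul (Real.contDiff_exp.pow 2)).sub contDiff_const).div_const _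
  · refine contDiffOn_const.mul (ContDiffOn.log (ContDiffOn.div ?_ ?_ ?_) ?_)
    · exact (contDiff_const.add Real.contDiff_exp).contDiffOn
    · exact (contDiff_const.sub Real.contDiff_exp).contDiffOn
    · exact fun t ht => (one_sub_exp_pos ht).ne'
    · exact fun t ht => (div_pos (by positivity) (one_sub_exp_pos ht)).ne'

theorem contDiffOn_deriv_truncProfile : ContDiffOn ℝ 1 (deriv truncProfile) (Iio 0) :=
  contDiffOn_truncProfile.deriv_of_isOpen isOpen_Iio (by norm_num)

theorem hasDerivAt_truncProfile {t : ℝ} (ht : t < 0) :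
    HasDerivAt truncProfile (deriv truncProfile t) t :=
  ((contDiffOn_truncProfile.differentiableOn (by norm_num)).differentiableAt
    (Iio_mem_nhds ht)).hasDerivAt

theorem hasDerivAt_deriv_truncProfile {t : ℝ} (ht : t < 0) :
    HasDerivAt (deriv truncProfile) (deriv (deriv truncProfile) t) t :=
  ((contDiffOn_deriv_truncProfile.differentiableOn (by norm_num)).differentiableAt
    (Iio_mem_nhds ht)).hasDerivAt

theorem truncProfile_eventuallyEq_zero {t : ℝ} (ht : Real.exp t < 1 / 4) :
    truncProfile =ᶠ[𝓝 t] fun _ => 0 := by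
  filter_upwards [(Real.continuous_exp.tendsto t).eventually (gt_mem_nhds ht)] with s hs
  have := Real.exp_pos s
  rw [truncProfile, cutoffProfile, Real.smoothTransition.zero_of_nonpos (by nlinarith), zero_mul]

theorem truncProfile_eventuallyEq_logProfile {t : ℝ} (ht : 1 / 2 < Real.exp t) :
    truncProfile =ᶠ[𝓝 t] logProfile := by
  filter_upwards [(Real.continuous_exp.tendsto t).eventually (lt_mem_nhds ht)] with s hs
  rw [truncProfile, cutoffProfile, Real.smoothTransition.one_of_one_le (by nlinarith), one_mul]

theorem deriv_truncProfile_of_lt {t : ℝ} (ht : Real.exp t < 1 / 4) :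
    deriv truncProfile t = 0 ∧ deriv (deriv truncProfile) t = 0 := by
  have h := truncProfile_eventuallyEq_zero ht
  rw [h.deriv.deriv_eq, h.deriv_eq]
  simp

theorem deriv_truncProfile_of_gt {t : ℝ} (ht : 1 / 2 < Real.exp t) (ht0 : t < 0) :
    deriv truncProfile t = Real.exp t / (1 - Real.exp t ^ 2) ∧
      deriv (deriv truncProfile) t =
        Real.exp t * (1 + Real.exp t ^ 2) / (1 - Real.exp t ^ 2) ^ 2 := by
  have h := truncProfile_eventuallyEq_logProfile ht
  have h' : deriv logProfile =ᶠ[𝓝 t] fun t => Real.exp t / (1 - Real.exp t ^ 2) := by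
    filter_upwards [Iio_mem_nhds ht0] with s hs using (hasDerivAt_logProfile hs).deriv
  rw [(h.deriv.trans h').deriv_eq, (h.deriv.trans h').eq_of_nhds]
  exact ⟨rfl, (hasDerivAt_deriv_logProfile ht0).deriv⟩

/-- The transition zone of the cutoff is a compact interval of `t`, and it is the only zone where
the derivatives have no explicit formula. -/
theorem exists_bound_deriv_truncProfile : ∃ K : ℝ, 1 ≤ K ∧ ∀ t, 1 / 4 ≤ Real.exp t →
    Real.exp t ≤ 1 / 2 → |deriv truncProfile t| ≤ K ∧ |deriv (deriv truncProfile) t| ≤ K := by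
  have hsub : Icc (Real.log (1 / 4)) (Real.log (1 / 2)) ⊆ Iio 0 := fun t ht =>
    ht.2.trans_lt (Real.log_neg (by norm_num) (by norm_num))
  have hc2 : ContinuousOn (deriv (deriv truncProfile)) (Iio 0) :=
    contDiffOn_deriv_truncProfile.continuousOn_deriv_of_isOpen isOpen_Iio le_rfl
  obtain ⟨K1, h1⟩ := isCompact_Icc.exists_bound_of_continuousOn
    (contDiffOn_deriv_truncProfile.continuousOn.mono hsub)
  obtain ⟨K2, h2⟩ := isCompact_Icc.exists_bound_of_continuousOn (hc2.mono hsub)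
  refine ⟨max 1 (max K1 K2), le_max_left _ _, fun t ha hb => ?_⟩
  have ht : t ∈ Icc (Real.log (1 / 4)) (Real.log (1 / 2)) :=
    ⟨(Real.log_le_iff_le_exp (by norm_num)).2 ha, (Real.le_log_iff_exp_le (by norm_num)).2 hb⟩
  exact ⟨(h1 t ht).trans (by simp), (h2 t ht).trans (by simp)⟩

/-- For a large constant `c`, the function `c r² + ρ ℓ_P` is a nondecreasing convex function of
`t = log r`, even strongly so. -/
theorem exists_truncProfile_estimate : ∃ c ε₀ : ℝ, 0 < c ∧ 0 < ε₀ ∧ ∀ t < 0,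
    0 ≤ 2 * c * Real.exp t ^ 2 + deriv truncProfile t ∧
    2 * ε₀ * (2 * c * Real.exp t ^ 2 + deriv truncProfile t) ^ 2 ≤
      4 * c * Real.exp t ^ 2 + deriv (deriv truncProfile) t := by
  obtain ⟨K, hK1, hK⟩ := exists_bound_deriv_truncProfile
  -- With `c = 8K` and `r = exp t ≥ 1/4`, the terms `2cr² ≥ K` and `4cr² ≥ 2K` absorb derivatives of
  -- size `K`. The value of `ε₀` makes `2ε₀ = 1/(64K)`, small enough in all three zones.
  refine ⟨8 * K, 1 / (128 * K), by positivity, by positivity, fun t ht => ?_⟩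
  have hr := Real.exp_pos t
  have hr1 : Real.exp t < 1 := by simpa using ht
  rcases lt_or_ge (Real.exp t) (1 / 4) with ha | ha
  · obtain ⟨e1, e2⟩ := deriv_truncProfile_of_lt ha
    rw [e1, e2]
    generalize Real.exp t = r at *
    refine ⟨by positivity, ?_⟩
    have : 2 * (1 / (128 * K)) * (2 * (8 * K) * r ^ 2 + 0) ^ 2 = 4 * K * r ^ 2 * r ^ 2 := by
      field_simp
      ring
    rw [this]
    have : r ^ 2 ≤ 1 := by nlinarith
    have : 4 * K * r ^ 2 * r ^ 2 ≤ 4 * K * r ^ 2 * 1 := by gcongr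
    nlinarith [sq_nonneg r, mul_nonneg (zero_le_one.trans hK1) (sq_nonneg r)]
  rcases le_or_gt (Real.exp t) (1 / 2) with hb | hb
  · obtain ⟨e1, e2⟩ := hK t ha hb
    generalize deriv truncProfile t = x at *
    generalize deriv (deriv truncProfile) t = y at *
    generalize Real.exp t = r at *
    rw [abs_le] at e1 e2
    have hK0 : 0 ≤ K := zero_le_one.trans hK1
    have m1 : 1 / 16 ≤ r ^ 2 := by nlinarith
    have m2 : r ^ 2 ≤ 1 / 4 := by nlinarith
    have l1 : K ≤ 16 * K * r ^ 2 := by linarith [mul_le_mul_of_nonneg_left m1 hK0]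
    have l2 : 16 * K * r ^ 2 ≤ 4 * K := by linarith [mul_le_mul_of_nonneg_left m2 hK0]
    have h0 : 0 ≤ 2 * (8 * K) * r ^ 2 + x := by linarith
    refine ⟨h0, ?_⟩
    have : (2 * (8 * K) * r ^ 2 + x) ^ 2 ≤ (5 * K) ^ 2 := by
      apply pow_le_pow_left₀ h0
      linarith
    calc 2 * (1 / (128 * K)) * (2 * (8 * K) * r ^ 2 + x) ^ 2
        ≤ 2 * (1 / (128 * K)) * (5 * K) ^ 2 := by gcongr
      _ = 25 / 64 * K := by field_simp; ring
      _ ≤ 4 * (8 * K) * r ^ 2 + y := by linarith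
  · obtain ⟨e1, e2⟩ := deriv_truncProfile_of_gt hb ht
    rw [e1, e2]
    generalize Real.exp t = r at *
    have hs : 0 < 1 - r ^ 2 := by nlinarith
    refine ⟨by positivity, ?_⟩
    set A := r / (1 - r ^ 2) with hA
    -- The inequality `(ℓ_P')² ≤ ℓ_P''`, which amounts to `r ≤ 1 + r²`, controls the blow-up at the
    -- unit circle.
    have hA2 : A ^ 2 ≤ r * (1 + r ^ 2) / (1 - r ^ 2) ^ 2 := by
      rw [hA, div_pow]
      gcongr
      nlinarith
    have h1 : (2 * (8 * K) * r ^ 2 + A) ^ 2 ≤ 2 * (16 * K * r ^ 2) ^ 2 + 2 * A ^ 2 := by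
      nlinarith [sq_nonneg (16 * K * r ^ 2 - A)]
    have h2 : r ^ 2 ≤ 1 := by nlinarith
    calc 2 * (1 / (128 * K)) * (2 * (8 * K) * r ^ 2 + A) ^ 2
        ≤ 2 * (1 / (128 * K)) * (2 * (16 * K * r ^ 2) ^ 2 + 2 * A ^ 2) := by gcongr
      _ = 8 * K * r ^ 2 * r ^ 2 + 1 / (32 * K) * A ^ 2 := by field_simp; ring
      _ ≤ 8 * K * r ^ 2 * 1 + 1 * A ^ 2 := by
          gcongr
          rw [div_le_one (by positivity)]
          linarith
      _ ≤ 4 * (8 * K) * r ^ 2 + r * (1 + r ^ 2) / (1 - r ^ 2) ^ 2 := by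
          have : 0 ≤ K * r ^ 2 := by positivity
          linarith

/-! ### From the profile to functions on the disk. -/

theorem Real.tanh_strictMono : StrictMono Real.tanh :=
  strictMono_of_hasDerivAt_pos Real.hasDerivAt_tanh fun x => by
    have := (sq_lt_one_iff_abs_lt_one _).2 (Real.abs_tanh_lt_one x)
    linarith

theorem poincareDist_zero_nonneg {z : ℂ} (hz : ‖z‖ < 1) : 0 ≤ poincareDist 0 z := by
  rw [poincareDist_zero_left]
  have := Real.log_nonneg (x := (1 + ‖z‖) / (1 - ‖z‖)) <| by
    rw [le_div_iff₀ (by linarith)]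
    linarith [norm_nonneg z]
  positivity

theorem continuousOn_poincareDist_zero :
    ContinuousOn (fun z : ℂ => poincareDist 0 z) (ball 0 1) := by
  simp only [poincareDist_zero_left]
  have h : ∀ z ∈ ball (0 : ℂ) 1, 0 < 1 - ‖z‖ := fun z hz => by
    have : ‖z‖ < 1 := by simpa using hz
    linarith
  refine continuousOn_const.mul (ContinuousOn.log (ContinuousOn.div ?_ ?_ fun z hz => (h z hz).ne')
    fun z hz => (div_pos (by positivity) (h z hz)).ne')
  · exact (continuous_const.add continuous_norm).continuousOn
  · exact (continuous_const.sub continuous_norm).continuousOn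

theorem ellFun_nonneg {c : ℝ} (hc : 0 ≤ c) {z : ℂ} (hz : ‖z‖ < 1) : 0 ≤ ellFun c cutoff id z :=
  add_nonneg (by positivity)
    (mul_nonneg (isCutoff_cutoff.mem_Icc _).1 (poincareDist_zero_nonneg hz))

theorem continuousOn_ellFun (c : ℝ) : ContinuousOn (ellFun c cutoff id) (ball (0 : ℂ) 1) :=
  (continuous_const.mul (continuous_norm.pow 2)).continuousOn.add
    (isCutoff_cutoff.smooth.continuous.continuousOn.mul continuousOn_poincareDist_zero)

theorem ellFun_zero (c : ℝ) : ellFun c cutoff id (0 : ℂ) = 0 := by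
  simp [ellFun, poincareDist]

theorem ellFun_eq_profile (c : ℝ) {z : ℂ} (hz : z ≠ 0) :
    ellFun c cutoff id z =
      c * Real.exp (Real.log ‖z‖) ^ 2 + truncProfile (Real.log ‖z‖) := by
  rw [truncProfile, ← cutoff_eq hz, ← poincareDist_zero_eq hz, Real.exp_log (norm_pos_iff.2 hz)]
  rfl

/-- A constant and a bound such that `tanh (ε l)` is subharmonic. -/
theorem exists_isLogConvexRadial : ∃ c ε₀ : ℝ, 0 < c ∧ 0 < ε₀ ∧
    IsLogConvexRadial (ellFun c cutoff id) ∧ ∀ ε, 0 < ε → ε ≤ ε₀ →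
      IsLogConvexRadial fun z => Real.tanh (ε * ellFun c cutoff id z) := by
  obtain ⟨c, ε₀, hc, hε₀, h⟩ := exists_truncProfile_estimate
  set ψ : ℝ → ℝ := fun t => c * Real.exp t ^ 2 + truncProfile t with hψ
  set ψ' : ℝ → ℝ := fun t => 2 * c * Real.exp t ^ 2 + deriv truncProfile t with hψ'
  have d1 : ∀ t ∈ Iio (0 : ℝ), HasDerivAt ψ (ψ' t) t := fun t ht => by
    refine ((((Real.hasDerivAt_exp t).pow 2).const_mul c).add
      (hasDerivAt_truncProfile ht)).congr_deriv ?_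
    simp only [hψ']
    push_cast
    ring
  have d2 : ∀ t ∈ Iio (0 : ℝ), HasDerivAt ψ'
      (4 * c * Real.exp t ^ 2 + deriv (deriv truncProfile) t) t := fun t ht => by
    refine ((((Real.hasDerivAt_exp t).pow 2).const_mul (2 * c)).add
      (hasDerivAt_deriv_truncProfile ht)).congr_deriv ?_
    push_cast
    ring
  have hlog : ∀ z : ℂ, z ≠ 0 → ‖z‖ < 1 → Real.log ‖z‖ ∈ Iio (0 : ℝ) := fun z hz hz1 =>
    Real.log_neg (norm_pos_iff.2 hz) hz1
  have hconv : ConvexOn ℝ (Iio (0 : ℝ)) ψ := by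
    refine convexOn_of_hasDerivWithinAt2_nonneg (convex_Iio 0)
      (fun t ht => (d1 t ht).continuousAt.continuousWithinAt)
      (fun t ht => (d1 t (interior_subset ht)).hasDerivWithinAt)
      (fun t ht => (d2 t (interior_subset ht)).hasDerivWithinAt) fun t ht => ?_
    have ht' : t < 0 := by simpa using ht
    exact le_trans (by positivity) (h t ht').2
  refine ⟨c, ε₀, hc, hε₀, ⟨continuousOn_ellFun c, fun z hz => ellFun_nonneg hc.le hz,
    ellFun_zero c, fun z hz hz1 => ⟨ψ' (Real.log ‖z‖), (h _ (hlog z hz hz1)).1, fun w hw hw1 => ?_⟩⟩,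
    fun ε hε hεε₀ => ⟨?_, fun z hz => ?_, ?_, fun z hz hz1 => ?_⟩⟩
  · rw [ellFun_eq_profile c hz, ellFun_eq_profile c hw]
    exact hconv.add_mul_sub_le_of_hasDerivAt (hlog z hz hz1) (hlog w hw hw1) (d1 _ (hlog z hz hz1))
  · exact (continuous_iff_continuousAt.2 fun x =>
      (Real.hasDerivAt_tanh x).continuousAt).comp_continuousOn
        (continuousOn_const.mul (continuousOn_ellFun c))
  · rw [← Real.tanh_zero]
    exact Real.tanh_strictMono.monotone (mul_nonneg hε.le (ellFun_nonneg hc.le hz))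
  · simp [ellFun_zero]
  · have hz' := hlog z hz hz1
    have hd : HasDerivAt (fun t => Real.tanh (ε * ψ t))
        ((1 - Real.tanh (ε * ψ (Real.log ‖z‖)) ^ 2) * (ε * ψ' (Real.log ‖z‖))) (Real.log ‖z‖) :=
      (Real.hasDerivAt_tanh _).comp _ ((d1 _ hz').const_mul ε)
    have hsq : Real.tanh (ε * ψ (Real.log ‖z‖)) ^ 2 < 1 := by
      rw [sq_lt_one_iff_abs_lt_one]
      exact Real.abs_tanh_lt_one _
    refine ⟨_, mul_nonneg (sub_nonneg.2 hsq.le) (mul_nonneg hε.le (h _ hz').1),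
      fun w hw hw1 => ?_⟩
    have hcv := convexOn_tanh_comp (convex_Iio 0) hε.le d1 d2 fun t ht =>
      le_trans (by gcongr) (h t ht).2
    have := hcv.add_mul_sub_le_of_hasDerivAt hz' (hlog w hw hw1) hd
    rwa [ellFun_eq_profile c hz, ellFun_eq_profile c hw]

/-- `l` controls the Poincaré distance to `0`. -/
theorem poincareDist_zero_le_ellFun {c : ℝ} (hc : 0 ≤ c) {z : ℂ} (hz : ‖z‖ < 1) :
    poincareDist 0 z ≤ ellFun c cutoff id z + 1 / 2 * Real.log 3 := by
  rcases le_or_gt (1 / 2) ‖z‖ with h | h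
  · have h1 : ellFun c cutoff id z = c * ‖z‖ ^ 2 + poincareDist 0 z := by
      simp only [ellFun, id]
      rw [isCutoff_cutoff.eq_one z (by linarith), one_mul]
    have : 0 ≤ c * ‖z‖ ^ 2 := by positivity
    have := Real.log_nonneg (x := 3) (by norm_num)
    linarith
  -- Here the cutoff may vanish, but the distance is at most its value `1/2 log 3` at radius `1/2`.
  · have h1 := ellFun_nonneg hc hz
    have : Real.log ((1 + ‖z‖) / (1 - ‖z‖)) ≤ Real.log 3 := by
      apply Real.log_le_log (div_pos (by positivity) (by linarith))
      rw [div_le_iff₀ (by linarith)]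
      linarith
    rw [poincareDist_zero_left]
    linarith

/-! ### A Harnack inequality. -/

section Harnack

variable {E : Type*} [NormedAddCommGroup E] [NormedSpace ℂ E]

/-- A Harnack inequality for holomorphic functions bounded by `1`. -/
theorem norm_le_one_add_norm_div_two {f : E → ℂ} {x y : E} {R : ℝ} (hR : 0 < R)
    (hf : DifferentiableOn ℂ f (ball x R)) (hf1 : ∀ z ∈ ball x R, ‖f z‖ < 1)
    (hy : 5 * ‖y - x‖ ≤ R) : ‖f y‖ ≤ (1 + ‖f x‖) / 2 := by
  have hx1 := hf1 x (mem_ball_self hR)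
  rcases eq_or_ne y x with rfl | hyx
  · linarith
  have hr : 0 < ‖y - x‖ := norm_pos_iff.2 (sub_ne_zero.2 hyx)
  rcases eq_or_ne (f y) 0 with hfy | hfy
  · rw [hfy, norm_zero]
    positivity
  -- Rotating by `u` makes `f y` real and positive, so a bound on real parts bounds `‖f y‖`.
  set u : ℂ := starRingEnd ℂ (f y) / ‖f y‖ with hu
  have hfy' : (‖f y‖ : ℂ) ≠ 0 := by simpa using hfy
  have hnu : ‖u‖ = 1 := by
    rw [hu, norm_div, RCLike.norm_conj, Complex.norm_real, norm_norm,
      div_self (norm_ne_zero_iff.2 hfy)]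
  have huy : u * f y = ‖f y‖ := by
    rw [hu, div_mul_eq_mul_div, mul_comm, Complex.mul_conj, Complex.normSq_eq_norm_sq]
    push_cast
    field_simp
  have hmaps : ∀ ζ ∈ ball (0 : ℂ) (R / ‖y - x‖), x + ζ • (y - x) ∈ ball x R := fun ζ hζ => by
    rw [mem_ball_zero_iff, lt_div_iff₀ hr] at hζ
    simpa [norm_smul] using hζ
  have hre : ∀ z, ‖f z‖ < 1 → (u * f z).re ≤ 1 := fun z hz => by
    refine (Complex.re_le_norm _).trans ?_
    rw [norm_mul, hnu, one_mul]
    exact hz.le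
  have hux : (u * f x).re ≤ ‖f x‖ := by
    refine (Complex.re_le_norm _).trans ?_
    rw [norm_mul, hnu, one_mul]
  have hM : 0 < 1 - (u * f x).re := by linarith
  have hRr : 5 ≤ R / ‖y - x‖ := by rwa [le_div_iff₀ hr]
  have hBC := Complex.borelCaratheodory_zero (f := fun ζ => u * f (x + ζ • (y - x)) - u * f x)
    (R := R / ‖y - x‖) (z := 1) hM ?_ ?_ (by positivity) ?_ (by simp)
  · have hle : (u * f y - u * f x).re ≤ ‖u * f y - u * f x‖ := Complex.re_le_norm _
    simp only [one_smul, add_sub_cancel, norm_one, mul_one] at hBC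
    -- The ratio `5` between the radius and `‖y - x‖` makes the Borel–Carathéodory factor `2 / (5 -
    -- 1) = 1/2`.
    have h2 : 2 * (1 - (u * f x).re) / (R / ‖y - x‖ - 1) ≤ (1 - (u * f x).re) / 2 := by
      rw [div_le_div_iff₀ (by linarith) (by norm_num)]
      nlinarith
    rw [Complex.sub_re] at hle
    have : (u * f y).re = ‖f y‖ := by rw [huy, Complex.ofReal_re]
    linarith
  · refine ((hf.comp (by fun_prop) hmaps).const_mul u).sub_const _
  · intro ζ hζ
    have := hre _ (hf1 _ (hmaps ζ hζ))
    simp only [mem_ofPred_eq, Complex.sub_re]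
    linarith
  · simpa using by linarith

end Harnack

/-! ### Möbius maps of the disk. -/

theorem norm_one_sub_conj_mul_sq (a b : ℂ) :
    ‖1 - starRingEnd ℂ b * a‖ ^ 2 = ‖a - b‖ ^ 2 + (1 - ‖a‖ ^ 2) * (1 - ‖b‖ ^ 2) := by
  simp only [← Complex.normSq_eq_norm_sq, Complex.normSq_apply, Complex.sub_re, Complex.sub_im,
    Complex.mul_re, Complex.mul_im, Complex.conj_re, Complex.conj_im, Complex.one_re,
    Complex.one_im]
  ring

theorem one_sub_conj_mul_ne_zero {a b : ℂ} (ha : ‖a‖ < 1) (hb : ‖b‖ < 1) :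
    1 - starRingEnd ℂ b * a ≠ 0 := by
  intro h
  have := norm_one_sub_conj_mul_sq a b
  rw [h, norm_zero] at this
  have h1 : 0 < 1 - ‖a‖ ^ 2 := by nlinarith [norm_nonneg a]
  have h2 : 0 < 1 - ‖b‖ ^ 2 := by nlinarith [norm_nonneg b]
  have := mul_pos h1 h2
  nlinarith [sq_nonneg ‖a - b‖]

theorem norm_moebius_lt_one {a b : ℂ} (ha : ‖a‖ < 1) (hb : ‖b‖ < 1) :
    ‖(a - b) / (1 - starRingEnd ℂ b * a)‖ < 1 := by
  have h0 := norm_pos_iff.2 (one_sub_conj_mul_ne_zero ha hb)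
  rw [norm_div, div_lt_one h0]
  refine lt_of_pow_lt_pow_left₀ 2 h0.le ?_
  rw [norm_one_sub_conj_mul_sq]
  have h1 : 0 < 1 - ‖a‖ ^ 2 := by nlinarith [norm_nonneg a]
  have h2 : 0 < 1 - ‖b‖ ^ 2 := by nlinarith [norm_nonneg b]
  have := mul_pos h1 h2
  linarith

theorem poincareDist_eq_zero_moebius (a b : ℂ) :
    poincareDist b a = poincareDist 0 ((a - b) / (1 - starRingEnd ℂ b * a)) := by
  have h : ‖(b - a) / (1 - starRingEnd ℂ a * b)‖ = ‖(a - b) / (1 - starRingEnd ℂ b * a)‖ := by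
    rw [norm_div, norm_div, norm_sub_rev b a,
      ← RCLike.norm_conj (1 - starRingEnd ℂ a * b)]
    simp [mul_comm]
  rw [poincareDist_zero_left, poincareDist, h]

/-! ### Holomorphic maps from a manifold to the disk. -/

section Manifold

variable {E : Type*} [NormedAddCommGroup E] [NormedSpace ℂ E]
  {M : Type*} [TopologicalSpace M] [ChartedSpace E M]

theorem zero_mem_holDisk : (fun _ => 0 : M → ℂ) ∈ HolDisk E M :=
  ⟨mdifferentiable_const, by simp⟩

instance nonempty_holDisk_vanishing (p : M) : Nonempty {h ∈ HolDisk E M | h p = 0} :=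
  ⟨⟨_, zero_mem_holDisk, rfl⟩⟩

theorem moebius_mem_holDisk {f : M → ℂ} (hf : f ∈ HolDisk E M) {b : ℂ} (hb : ‖b‖ < 1) :
    (fun x => (f x - b) / (1 - starRingEnd ℂ b * f x)) ∈ HolDisk E M := by
  refine ⟨fun x => ?_, fun x => norm_moebius_lt_one (hf.2 x) hb⟩
  have hd : DifferentiableAt ℂ (fun z => (z - b) / (1 - starRingEnd ℂ b * z)) (f x) :=
    (differentiableAt_id.sub_const b).div
      ((differentiableAt_const _).sub (differentiableAt_id.const_mul _))
      (one_sub_conj_mul_ne_zero (hf.2 x) hb)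
  exact hd.mdifferentiableAt.comp x (hf.1 x)

/-- The Carathéodory pseudo-distance from `p` is determined by the maps that vanish at `p`. -/
theorem caratheodoryDist_le {p x : M} {r : ℝ}
    (h : ∀ f ∈ HolDisk E M, f p = 0 → poincareDist 0 (f x) ≤ r) :
    caratheodoryDist E p x ≤ ENNReal.ofReal r := by
  refine iSup₂_le fun f hf => ENNReal.ofReal_le_ofReal ?_
  rw [poincareDist_eq_zero_moebius]
  have hg := moebius_mem_holDisk hf (hf.2 p)
  generalize hgf : (fun y => (f y - f p) / (1 - starRingEnd ℂ (f p) * f y)) = g at hg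
  have hgp : g p = 0 := by simp [← hgf]
  have hgx : g x = (f x - f p) / (1 - starRingEnd ℂ (f p) * f x) := by rw [← hgf]
  rw [← hgx]
  exact h g hg hgp

theorem HolDisk.differentiableOn_comp_symm {f : M → ℂ} (hf : f ∈ HolDisk E M)
    {e : OpenPartialHomeomorph M E} (he : e ∈ IsManifold.maximalAtlas 𝓘(ℂ, E) ω M) :
    DifferentiableOn ℂ (f ∘ e.symm) e.target := by
  rw [← mdifferentiableOn_iff_differentiableOn]
  exact hf.1.comp_mdifferentiableOn
    ((contMDiffOn_symm_of_mem_maximalAtlas he).mdifferentiableOn (by simp))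

theorem HolDisk.continuous {f : M → ℂ} (hf : f ∈ HolDisk E M) : Continuous f := hf.1.continuous

theorem circleIntegrable_comp_chart_line {E : Type*} [NormedAddCommGroup E] [NormedSpace ℂ E]
    {M : Type*} [TopologicalSpace M] {u : M → ℝ} (hu : Continuous u)
    {e : OpenPartialHomeomorph M E} {z w : E} (h : ∀ ζ : ℂ, ‖ζ‖ ≤ 1 → z + ζ • w ∈ e.target) :
    CircleIntegrable (fun ζ : ℂ => (u ∘ e.symm) (z + ζ • w)) 0 1 := by
  apply ContinuousOn.circleIntegrable zero_le_one
  refine (hu.comp_continuousOn e.continuousOn_symm).comp (by fun_prop) fun ζ hζ => h ζ ?_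
  exact (mem_sphere_zero_iff_norm.1 hζ).le

theorem IsLogConvexRadial.plurisubharmonic_comp {G : ℂ → ℝ} (hG : IsLogConvexRadial G)
    {f : M → ℂ} (hf : f ∈ HolDisk E M) : Plurisubharmonic E fun x => G (f x) := by
  intro e he
  have hc : Continuous fun x => G (f x) := by
    rw [← continuousOn_univ]
    exact hG.continuousOn_comp (HolDisk.continuous hf).continuousOn fun x _ => hf.2 x
  refine ⟨(hc.comp_continuousOn e.continuousOn_symm).upperSemicontinuousOn, fun z w h =>
    ⟨circleIntegrable_comp_chart_line hc h, ?_⟩⟩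
  have hV : IsOpen {ζ : ℂ | z + ζ • w ∈ e.target} := e.open_target.preimage (by fun_prop)
  have hd : DifferentiableOn ℂ (fun ζ : ℂ => (f ∘ e.symm) (z + ζ • w))
      {ζ : ℂ | z + ζ • w ∈ e.target} :=
    (HolDisk.differentiableOn_comp_symm hf he).comp (by fun_prop) fun ζ hζ => hζ
  have := hG.le_circleAverage_comp
    ((hd.analyticOnNhd hV).mono fun ζ hζ => h ζ (mem_closedBall_zero_iff.1 hζ))
    fun ζ _ => hf.2 _
  simpa using this

/-- A continuous supremum of plurisubharmonic functions is plurisubharmonic. -/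
theorem plurisubharmonic_iSup {ι : Type*} [Nonempty ι] {u : ι → M → ℝ}
    (hu : ∀ i, Plurisubharmonic E (u i)) (hb : ∀ x, BddAbove (range fun i => u i x))
    (hc : Continuous fun x => ⨆ i, u i x) : Plurisubharmonic E fun x => ⨆ i, u i x := by
  intro e he
  refine ⟨(hc.comp_continuousOn e.continuousOn_symm).upperSemicontinuousOn, fun z w h =>
    ⟨circleIntegrable_comp_chart_line hc h, ciSup_le fun i => ?_⟩⟩
  obtain ⟨hi, hle⟩ := (hu i e he).2 z w h
  exact hle.trans (Real.circleAverage_mono hi (circleIntegrable_comp_chart_line hc h)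
    fun ζ _ => le_ciSup (hb _) i)

/-- Near every point, the holomorphic maps to the disk satisfy a uniform Harnack inequality and are
equicontinuous. -/
theorem HolDisk.exists_nhds_harnack [IsManifold 𝓘(ℂ, E) ω M] (x₀ : M) : ∃ N ∈ 𝓝 x₀,
    (∀ x ∈ N, ∀ y ∈ N, ∀ f ∈ HolDisk E M, ‖f y‖ ≤ (1 + ‖f x‖) / 2) ∧
    ∀ δ > 0, ∃ N' ∈ 𝓝 x₀, ∀ x ∈ N', ∀ f ∈ HolDisk E M, dist (f x) (f x₀) < δ := by
  set e := chartAt E x₀ with he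
  have hx₀ : x₀ ∈ e.source := mem_chart_source E x₀
  obtain ⟨R, hR, hball⟩ := Metric.isOpen_iff.1 e.open_target (e x₀) (e.map_source hx₀)
  have hnhds : ∀ r > 0, e.source ∩ e ⁻¹' ball (e x₀) r ∈ 𝓝 x₀ := fun r hr =>
    inter_mem (e.open_source.mem_nhds hx₀)
      ((e.continuousAt hx₀).preimage_mem_nhds (ball_mem_nhds _ hr))
  have hd : ∀ f ∈ HolDisk E M, DifferentiableOn ℂ (f ∘ e.symm) (ball (e x₀) R) := fun f hf =>
    (HolDisk.differentiableOn_comp_symm hf (IsManifold.chart_mem_maximalAtlas x₀)).mono hball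
  -- Two points within `R/20` of the centre are less than `R/10` apart, one fifth of the radius
  -- `R/2` used in Harnack.
  refine ⟨_, hnhds (R / 20) (by positivity), fun x hx y hy f hf => ?_, fun δ hδ => ?_⟩
  · have hxy : ball (e x) (R / 2) ⊆ ball (e x₀) R := by
      refine ball_subset_ball' ?_
      have : dist (e x) (e x₀) < R / 20 := hx.2
      linarith
    have := norm_le_one_add_norm_div_two (y := e y) (by positivity : 0 < R / 2)
      ((hd f hf).mono hxy) (fun z _ => hf.2 _) <| by
        have h1 : dist (e x) (e x₀) < R / 20 := hx.2
        have h2 : dist (e y) (e x₀) < R / 20 := hy.2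
        have := dist_triangle_right (e y) (e x) (e x₀)
        rw [← dist_eq_norm]
        linarith
    simpa [e.left_inv hx.1, e.left_inv hy.1] using this
  · refine ⟨_, hnhds (min R (δ * R / 2)) (by positivity), fun x hx f hf => ?_⟩
    have h1 : dist (e x) (e x₀) < min R (δ * R / 2) := hx.2
    -- Schwarz lemma: all values lie within `2` of `f x₀`, so every `f` satisfies the same estimate
    -- with constant `2/R`.
    have := Complex.dist_le_div_mul_dist_of_mapsTo_ball (R₂ := 2) (hd f hf) (fun z _ => by
      rw [mem_closedBall, dist_eq_norm]
      have := norm_sub_le ((f ∘ e.symm) z) ((f ∘ e.symm) (e x₀))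
      have h2 : ‖(f ∘ e.symm) z‖ < 1 := hf.2 _
      have h3 : ‖(f ∘ e.symm) (e x₀)‖ < 1 := hf.2 _
      linarith) (mem_ball.2 (h1.trans_le (min_le_left _ _)))
    simp only [Function.comp_apply, e.left_inv hx.1, e.left_inv hx₀] at this
    have h4 : 2 / R * dist (e x) (e x₀) < 2 / R * (δ * R / 2) := by
      have := h1.trans_le (min_le_right _ _)
      gcongr
    have h5 : 2 / R * (δ * R / 2) = δ := by field_simp
    linarith

/-- On a connected manifold, the maps to the disk that vanish at `p` are, at every point, bounded
away from the unit circle. -/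
theorem HolDisk.exists_norm_le [IsManifold 𝓘(ℂ, E) ω M] [ConnectedSpace M] (p x : M) :
    ∃ r < 1, ∀ f ∈ HolDisk E M, f p = 0 → ‖f x‖ ≤ r := by
  set S : M → Prop := fun x => ∃ r < 1, ∀ f ∈ HolDisk E M, f p = 0 → ‖f x‖ ≤ r with hS
  -- Harnack is symmetric in the two points, so `S` is both open and closed; it holds at `p` with `r
  -- = 0`.
  have hloc : IsLocallyConstant S := by
    refine (IsLocallyConstant.iff_eventually_eq S).2 fun x₀ => ?_
    obtain ⟨N, hN, hH, -⟩ := HolDisk.exists_nhds_harnack (E := E) x₀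
    have key : ∀ x ∈ N, ∀ y ∈ N, S x → S y := fun x hx y hy ⟨r, hr, h⟩ =>
      ⟨(1 + r) / 2, by linarith, fun f hf hfp => by linarith [hH x hx y hy f hf, h f hf hfp]⟩
    filter_upwards [hN] with y hy
    exact propext ⟨key y hy x₀ (mem_of_mem_nhds hN), key x₀ (mem_of_mem_nhds hN) y hy⟩
  have hp : S p := ⟨0, one_pos, fun f _ hfp => by simp [hfp]⟩
  have := hloc.apply_eq_of_preconnectedSpace p x
  exact this.mp hp

/-- The supremum of the functions `G ∘ f` over the maps `f` to the disk that vanish at `p` is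
continuous. -/
theorem continuous_iSup_comp_holDisk [IsManifold 𝓘(ℂ, E) ω M] [ConnectedSpace M] {G : ℂ → ℝ}
    (hG : ContinuousOn G (ball 0 1)) {B : ℝ} (hB : ∀ z, G z ≤ B) (p : M) :
    Continuous fun x => ⨆ h : {h ∈ HolDisk E M | h p = 0}, G (h.1 x) := by
  have hb : ∀ x, BddAbove (range fun h : {h ∈ HolDisk E M | h p = 0} => G (h.1 x)) := fun x =>
    ⟨B, by rintro _ ⟨h, rfl⟩; exact hB _⟩
  refine continuous_iff_continuousAt.2 fun x₀ => Metric.continuousAt_iff'.2 fun η hη => ?_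
  obtain ⟨r, hr, hrx⟩ := HolDisk.exists_norm_le (E := E) p x₀
  obtain ⟨N, hN, hH, hE⟩ := HolDisk.exists_nhds_harnack (E := E) x₀
  -- Harnack keeps the values at points near `x₀` in the disk of radius `(1 + r)/2`. Uniform
  -- continuity there turns equicontinuity of the maps into an estimate uniform in `h`.
  have hUC : UniformContinuousOn G (closedBall 0 ((1 + r) / 2)) :=
    (isCompact_closedBall _ _).uniformContinuousOn_of_continuous
      (hG.mono (closedBall_subset_ball (by linarith)))
  obtain ⟨δ, hδ, hGδ⟩ := Metric.uniformContinuousOn_iff.1 hUC (η / 2) (by positivity)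
  obtain ⟨N', hN', hE'⟩ := hE δ hδ
  filter_upwards [hN, hN'] with x hx hx'
  have hclose : ∀ h : {h ∈ HolDisk E M | h p = 0}, |G (h.1 x) - G (h.1 x₀)| < η / 2 := fun h => by
    have h0 := hrx h.1 h.2.1 h.2.2
    refine hGδ _ ?_ _ ?_ (hE' x hx' h.1 h.2.1)
    · rw [mem_closedBall_zero_iff]
      linarith [hH x₀ (mem_of_mem_nhds hN) x hx h.1 h.2.1]
    · rw [mem_closedBall_zero_iff]
      linarith
  have h1 : (⨆ h : {h ∈ HolDisk E M | h p = 0}, G (h.1 x)) ≤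
      (⨆ h : {h ∈ HolDisk E M | h p = 0}, G (h.1 x₀)) + η / 2 := ciSup_le fun h => by
    linarith [le_ciSup (hb x₀) h, (abs_lt.1 (hclose h)).2]
  have h2 : (⨆ h : {h ∈ HolDisk E M | h p = 0}, G (h.1 x₀)) ≤
      (⨆ h : {h ∈ HolDisk E M | h p = 0}, G (h.1 x)) + η / 2 := ciSup_le fun h => by
    linarith [le_ciSup (hb x) h, (abs_lt.1 (hclose h)).1]
  rw [Real.dist_eq, abs_lt]
  constructor <;> linarith

/-! ### The exhaustion function `φ_p`. -/

section SupTanh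

variable {c ε : ℝ} (hc : 0 < c) (hε : 0 < ε)
  (hG : IsLogConvexRadial fun z => Real.tanh (ε * ellFun c cutoff id z))

theorem bddAbove_range_tanh (c ε : ℝ) (p x : M) :
    BddAbove (range fun h : {h ∈ HolDisk E M | h p = 0} =>
      Real.tanh (ε * ellFun c cutoff h.1 x)) :=
  ⟨1, by rintro _ ⟨h, rfl⟩; exact (Real.tanh_lt_one _).le⟩

include hG in
theorem plurisubharmonic_supTanh [IsManifold 𝓘(ℂ, E) ω M] [ConnectedSpace M] (p : M) :
    Plurisubharmonic E (supTanh E c cutoff ε p) :=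
  plurisubharmonic_iSup (fun h => hG.plurisubharmonic_comp h.2.1) (bddAbove_range_tanh c ε p)
    (continuous_iSup_comp_holDisk hG.continuousOn (fun _ => (Real.tanh_lt_one _).le) p)

include hG in
theorem supTanh_nonneg (p x : M) : 0 ≤ supTanh E c cutoff ε p x :=
  Real.iSup_nonneg fun h => hG.nonneg _ (h.2.1.2 x)

-- A supremum of numbers below `1` could equal `1`; here all `h x` lie in one compact disk, where
-- the continuous function attains a maximum below `1`.
include hG in
theorem supTanh_lt_one [IsManifold 𝓘(ℂ, E) ω M] [ConnectedSpace M] (p x : M) :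
    supTanh E c cutoff ε p x < 1 := by
  obtain ⟨r, hr, hrx⟩ := HolDisk.exists_norm_le (E := E) p x
  have hr0 : 0 ≤ r := by simpa using hrx _ zero_mem_holDisk rfl
  obtain ⟨z, -, hz⟩ := (isCompact_closedBall (0 : ℂ) r).exists_isMaxOn
    ⟨0, mem_closedBall_self hr0⟩ (hG.continuousOn.mono (closedBall_subset_ball hr))
  refine (ciSup_le fun h => ?_).trans_lt (Real.tanh_lt_one (ε * ellFun c cutoff id z))
  exact hz (mem_closedBall_zero_iff.2 (hrx h.1 h.2.1 h.2.2))

-- Places sublevel sets of `φ_p` inside Carathéodory balls, the link to completeness.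
include hc hε in
theorem caratheodoryDist_le_of_supTanh_lt {p x : M} {b : ℝ} (hb : b ∈ Ioo (-1) 1)
    (h : supTanh E c cutoff ε p x < b) :
    caratheodoryDist E p x ≤ ENNReal.ofReal (Real.artanh b / ε + 1 / 2 * Real.log 3) := by
  refine caratheodoryDist_le fun f hf hfp => ?_
  have h1 : Real.tanh (ε * ellFun c cutoff f x) < b :=
    (le_ciSup (bddAbove_range_tanh c ε p x) ⟨f, hf, hfp⟩).trans_lt h
  rw [← Real.tanh_artanh hb, Real.tanh_strictMono.lt_iff_lt] at h1
  have h2 : ellFun c cutoff id (f x) ≤ Real.artanh b / ε := by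
    rw [le_div_iff₀ hε, mul_comm]
    exact h1.le
  linarith [poincareDist_zero_le_ellFun hc.le (hf.2 x)]

include hc hε hG in
theorem isExhaustionBoundedBy_supTanh [IsManifold 𝓘(ℂ, E) ω M] [T2Space M] [ConnectedSpace M]
    (hM : StronglyCaratheodoryHyperbolic E M) (p : M) :
    IsExhaustionBoundedBy (supTanh E c cutoff ε p) 1 := by
  refine ⟨supTanh_lt_one hG p, fun b hb => ?_⟩
  -- Enlarging `b` to `b'` puts it in the interval where `artanh` inverts `tanh`.
  set b' := max b 0 with hb'
  have hmem : b' ∈ Ioo (-1 : ℝ) 1 :=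
    ⟨neg_one_lt_zero.trans_le (le_max_right _ _), max_lt hb one_pos⟩
  have hK := hM.complete p (Real.artanh b' / ε + 1 / 2 * Real.log 3).toNNReal
  exact hK.closure_of_subset fun x hx =>
    caratheodoryDist_le_of_supTanh_lt hc hε hmem (lt_of_lt_of_le hx (le_max_left _ _))

end SupTanh

end Manifold

end

theorem mainTheorem6 {E : Type*} [NormedAddCommGroup E] [NormedSpace ℂ E] [FiniteDimensional ℂ E]
    {M : Type*} [TopologicalSpace M] [ChartedSpace E M] [IsManifold 𝓘(ℂ, E) ω M]
    [T2Space M] [SecondCountableTopology M] [ConnectedSpace M]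
    (hM : StronglyCaratheodoryHyperbolic E M) :
    Hyperconvex E M ∧
      ∀ p : M, ∃ (a : ℝ) (ρ : ℂ → ℝ) (c ε₀ : ℝ),
        0 < a ∧ 2 * a < 1 ∧ IsCutoff a ρ ∧ 0 < c ∧ 0 < ε₀ ∧
        (∀ h ∈ HolDisk E M, h p = 0 → Plurisubharmonic E (ellFun c ρ h)) ∧
        ∀ ε : ℝ, 0 < ε → ε ≤ ε₀ →
          Plurisubharmonic E (supTanh E c ρ ε p) ∧
          (∀ x, 0 ≤ supTanh E c ρ ε p x) ∧
          IsExhaustionBoundedBy (supTanh E c ρ ε p) 1 := by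
  obtain ⟨c, ε₀, hc, hε₀, hell, htanh⟩ := exists_isLogConvexRadial
  refine ⟨?_, fun p => ⟨1 / 4, cutoff, c, ε₀, by norm_num, by norm_num, isCutoff_cutoff, hc, hε₀,
    fun h hh _ => hell.plurisubharmonic_comp hh, fun ε hε hεε₀ =>
      ⟨plurisubharmonic_supTanh (htanh ε hε hεε₀) p, supTanh_nonneg (htanh ε hε hεε₀) p,
        isExhaustionBoundedBy_supTanh hc hε (htanh ε hε hεε₀) hM p⟩⟩⟩
  obtain ⟨p⟩ := (inferInstance : Nonempty M)
  exact ⟨supTanh E c cutoff ε₀ p, 1, plurisubharmonic_supTanh (htanh ε₀ hε₀ le_rfl) p,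
    isExhaustionBoundedBy_supTanh hc hε₀ (htanh ε₀ hε₀ le_rfl) hM p⟩
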